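/- Let $R$ be a commutative unital ring, $t$ an indeterminate, $f(t)=\sum_{M\ge 0} f_M t^M\in R[[t]]$ an arbitrary formal power series, $n\ge 1$ an integer, and $\mathbf u=(u_1,\dots,u_n)^T,\ \mathbf v=(v_1,\dots,v_n)^T\in R^n$. Let $f[t\,\mathbf u\mathbf v^T]$ be the $n\times n$ matrix over $R[[t]]$ with $(j,k)$ entry $f(t\,u_jv_k)$, and let $V(\mathbf u):=\prod_{1\le j<k\le n}(u_k-u_j)$ be the Vandermonde determinant (equal to $1$ if $n=1$). For integers $0\le m_0\le\cdots\le m_{n-1}$ and $\mathbf m=(m_{n-1},\dots,m_0)$, put $s_{\mathbf m}(\mathbf u):=0$ if two of the $m_k$ coincide; otherwise let $$s_{\mathbf m}(\mathbf u):=\sum_T\prod_{j=1}^n u_j^{f_j(T)},$$ where $T$ runs over all column-strict Young tableaux (rows weakly increasing from left to right, columns strictly increasing from top to bottom) with entries in $\{1,\dots,n\}$ and with row lengths $m_{n-1}-(n-1),\dots,m_1-1,m_0$ from top to bottom, and $f_j(T)$ is the number of cells of $T$ with entry $j$. Then, in $R[[t]]$, $$\det f[t\,\mathbf u\mathbf v^T]=V(\mathbf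 u)V(\mathbf v)\sum_{M\ge\binom n2}t^M\sum_{\mathbf m\,\vdash M}s_{\mathbf m}(\mathbf u)\,s_{\mathbf m}(\mathbf v)\prod_{k=0}^{n-1}f_{m_k},$$ where the inner sum is over all $\mathbf m=(m_{n-1},\dots,m_0)$ with $m_{n-1}\ge\cdots\ge m_0\ge 0$ and $m_0+\cdots+m_{n-1}=M$. -/

import Mathlib

open scoped PowerSeries

namespace SchurDet

/-- `V(u) = ∏_{j < k} (u_k - u_j)`; it equals `1` for `n = 1` (empty product). -/
def vandermondeDet {R : Type*} [CommRing R] {n : ℕ} (u : Fin n → R) : R :=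
  ∏ j : Fin n, ∏ k ∈ Finset.Ioi j, (u k - u j)

/-- Column-strict (semistandard) Young tableaux of shape `μ` all of whose cell entries lie in an
alphabet of `m` letters, here `0, 1, …, m - 1`. -/
def Tableau (μ : YoungDiagram) (m : ℕ) : Type :=
  {T : SemistandardYoungTableau μ // ∀ c ∈ μ.cells, T c.1 c.2 < m}

instance Tableau.instFinite (μ : YoungDiagram) (m : ℕ) : Finite (Tableau μ m) := by
  refine Finite.of_injective
    (fun (T : Tableau μ m) (c : μ.cells) => (⟨T.1 c.1.1 c.1.2, T.2 c.1 c.2⟩ : Fin m)) ?_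
  intro S T h
  apply Subtype.ext
  ext i j
  by_cases hc : (i, j) ∈ μ
  · have := congrFun h ⟨(i, j), (YoungDiagram.mem_cells (i, j)).2 hc⟩
    simpa using this
  · rw [S.1.zeros hc, T.1.zeros hc]

noncomputable instance Tableau.instFintype (μ : YoungDiagram) (m : ℕ) : Fintype (Tableau μ m) :=
  Fintype.ofFinite _

/-- The weight `∏_j u_j ^ {f_j}`, with `f_j` the number of cells of `T` with entry `j`. -/
def Tableau.weight {R : Type*} [CommRing R] {μ : YoungDiagram} {m : ℕ}
    (T : Tableau μ m) (u : Fin m → R) : R :=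
  ∏ j : Fin m, u j ^ (μ.cells.filter fun c => T.1 c.1 c.2 = (j : ℕ)).card

/-- For `0 ≤ a_0 < ⋯ < a_{N-1}`, the list of row lengths
`(a_{N-1} - (N - 1), …, a_1 - 1, a_0 - 0)`, from the top row to the bottom row. -/
def rowList {N : ℕ} (a : Fin N → ℕ) : List ℕ :=
  List.ofFn fun i : Fin N => a i.rev - (i.rev : ℕ)

theorem rowList_sortedGE {N : ℕ} {a : Fin N → ℕ} (ha : StrictMono a) :
    (rowList a).SortedGE := by
  have key : ∀ d : ℕ, ∀ p q : Fin N, (q : ℕ) = p + d → a p + d ≤ a q := by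
    intro d
    induction d with
    | zero =>
      intro p q h
      have : p = q := Fin.ext (by omega)
      simp [this]
    | succ d ih =>
      intro p q h
      have h1 := ih p ⟨p + d, by omega⟩ rfl
      have h2 : a ⟨p + d, by omega⟩ < a q := ha (Fin.lt_def.2 (by simp; omega))
      omega
  unfold rowList
  rw [List.sortedGE_ofFn_iff]
  intro i j hij
  have h := key ((i.rev : ℕ) - j.rev) j.rev i.rev (by
    have := Fin.rev_le_rev.2 hij
    rw [Fin.le_def] at this
    omega)
  have h' : (j.rev : ℕ) ≤ i.rev := Fin.rev_le_rev.2 hij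
  show a j.rev - (j.rev : ℕ) ≤ a i.rev - (i.rev : ℕ)
  omega

/-- The shape `(a_{N-1}, …, a_1, a_0) - (N - 1, …, 1, 0)` as a Young diagram. -/
def shape {N : ℕ} (a : Fin N → ℕ) (ha : StrictMono a) : YoungDiagram :=
  YoungDiagram.ofRowLens (rowList a) (rowList_sortedGE ha)

open Classical in
/-- The Schur polynomial `s_a(u)` of a tuple `a_0 ≤ ⋯ ≤ a_{N-1}`, evaluated at `u`: the sum of the
weights of all column-strict tableaux of shape `(a_{N-1}, …, a_0) - (N - 1, …, 0)` if the `a_k`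
are strictly increasing, and `0` if two of them coincide. -/
noncomputable def schur {R : Type*} [CommRing R] {N m : ℕ} (a : Fin N → ℕ) (u : Fin m → R) : R :=
  if ha : StrictMono a then ∑ T : Tableau (shape a ha) m, T.weight u else 0

open Classical in
/-- The partitions `M = a_0 + ⋯ + a_{n-1}` with `0 ≤ a_0 ≤ ⋯ ≤ a_{n-1}`. -/
noncomputable def partitions (n M : ℕ) : Finset (Fin n → ℕ) :=
  ((Finset.univ : Finset (Fin n)).piAntidiag M).filter Monotone

/-- `f[A]`: the composition of `f` with every entry of a matrix `A` of power series. -/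
noncomputable def entrywise {R : Type*} [CommRing R] {n : ℕ} (f : R⟦X⟧)
    (A : Matrix (Fin n) (Fin n) R⟦X⟧) : Matrix (Fin n) (Fin n) R⟦X⟧ :=
  A.map fun g => f.subst g

end SchurDet

/-! ### Alternants: branching rule and Cauchy–Binet expansion -/

namespace SchurDet

open Finset Matrix

/-! Since `f(t u_j v_k)` is the sum of `f_m t^m u_j^m v_k^m`, the determinant expands over one
exponent `a_j` per row (`coeff_det_entrywise`). Repeated exponents contribute nothing; collecting
the rearrangements of each strictly increasing tuple produces a product of two alternants
(`sum_piAntidiag_eq_sum_strictMono`).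

It remains to see that an alternant is the Vandermonde product times a Schur polynomial. This goes
by induction on the number of variables: splitting off the last variable gives the same sum over
interlacing tuples on both sides, by row operations for alternants (`alternant_succ`) and by
deleting the largest letter for tableaux (`schur_succ`). -/

theorem vandermondeDet_succ {R : Type*} [CommRing R] {n : ℕ} (u : Fin (n + 1) → R) :
    vandermondeDet u = vandermondeDet (fun j : Fin n => u j.castSucc) *
      ∏ j : Fin n, (u (Fin.last n) - u j.castSucc) := by
  have key (m : ℕ) (w : Fin m → R) :
      vandermondeDet w = ∏ j, ∏ k, if j < k then w k - w j else 1 := by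
    refine prod_congr rfl fun j _ => ?_
    rw [← prod_filter]
    exact prod_congr (by ext; simp) fun _ _ => rfl
  rw [key, key, Fin.prod_univ_castSucc, ← prod_mul_distrib]
  rw [prod_eq_one (s := univ) (f := fun k => if Fin.last n < k then u k - u (Fin.last n) else 1)
    (fun k _ => if_neg (Fin.le_last k).not_gt), mul_one]
  refine prod_congr rfl fun j _ => ?_
  rw [Fin.prod_univ_castSucc, if_pos (Fin.castSucc_lt_last j)]
  simp only [Fin.castSucc_lt_castSucc_iff]

/-- The alternant `det (u_j ^ {a_k})`. -/
def alternant {R : Type*} [CommRing R] {n : ℕ} (a : Fin n → ℕ) (u : Fin n → R) : R :=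
  (Matrix.of fun k j => u j ^ a k).det

/-- The tuples `b` interlacing `a`: `a_k ≤ b_k < a_{k+1}`. -/
def interlacing {n : ℕ} (a : Fin (n + 1) → ℕ) : Finset (Fin n → ℕ) :=
  Fintype.piFinset fun k => Ico (a k.castSucc) (a k.succ)

theorem mem_interlacing {n : ℕ} {a : Fin (n + 1) → ℕ} {b : Fin n → ℕ} :
    b ∈ interlacing a ↔ ∀ k, a k.castSucc ≤ b k ∧ b k < a k.succ := by
  simp [interlacing]

theorem strictMono_of_mem_interlacing {n : ℕ} {a : Fin (n + 1) → ℕ} {b : Fin n → ℕ}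
    (ha : StrictMono a) (hb : b ∈ interlacing a) : StrictMono b := by
  rw [mem_interlacing] at hb
  intro i j hij
  refine (hb i).2.trans_le (le_trans (ha.monotone ?_) (hb j).1)
  rw [Fin.le_def]
  simpa using hij

theorem alternant_succ {R : Type*} [CommRing R] {n : ℕ} {a : Fin (n + 1) → ℕ}
    (ha : Monotone a) (u : Fin (n + 1) → R) :
    alternant a u = (∏ j : Fin n, (u (Fin.last n) - u j.castSucc)) *
      ∑ b ∈ interlacing a, u (Fin.last n) ^ (a 0 + ∑ k, (a k.succ - 1 - b k)) *
        alternant b fun j => u j.castSucc := by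
  set x := u (Fin.last n) with hx
  let S : Fin n → Fin (n + 1) → R := fun k j =>
    ∑ i ∈ Ico (a k.castSucc) (a k.succ), u j ^ i * x ^ (a k.succ - 1 - i)
  let B : Matrix (Fin (n + 1)) (Fin (n + 1)) R :=
    Matrix.of (Fin.cons (fun j => u j ^ a 0) fun k j => (u j - x) * S k j)
  have hB0 (j) : B 0 j = u j ^ a 0 := rfl
  have hBs (k : Fin n) (j) : B k.succ j = (u j - x) * S k j := rfl
  have hdet : alternant a u = B.det := by
    -- Each row minus `x ^ (a k.succ - a k.castSucc)` times its predecessor is `u j - x` times a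
    -- geometric sum, so the last column vanishes below the top.
    refine det_eq_of_forall_row_eq_smul_add_pred
      (fun k => x ^ (a k.succ - a k.castSucc)) (fun j => ?_) fun k j => ?_
    · simp [hB0]
    · rw [hBs, mul_geom_sum₂_Ico _ _ (ha k.castSucc_le_succ)]
      simp [mul_comm]
  have hsub : (B.submatrix (Fin.succAbove 0) (Fin.last n).succAbove).det =
      (∏ j : Fin n, (u j.castSucc - x)) *
        (Matrix.of fun k j : Fin n => S k j.castSucc).det := by
    rw [← det_mul_row]
    congr 1
    ext k j
    simp [hBs]
  have hmul : (Matrix.of fun k j : Fin n => S k j.castSucc).det =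
      ∑ b ∈ interlacing a, x ^ (∑ k, (a k.succ - 1 - b k)) *
        alternant b fun j => u j.castSucc := by
    -- By multilinearity, choosing one summand in each row amounts to choosing an interlacing tuple
    -- `b`.
    have h := (detRowAlternating (R := R) (n := Fin n)).toMultilinearMap.map_sum_finset
      (fun (k : Fin n) (i : ℕ) (j : Fin n) => u j.castSucc ^ i * x ^ (a k.succ - 1 - i))
      (fun k => Ico (a k.castSucc) (a k.succ))
    have h1 : (Matrix.of fun k j : Fin n => S k j.castSucc) =
        fun k => ∑ i ∈ Ico (a k.castSucc) (a k.succ),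
          fun j : Fin n => u j.castSucc ^ i * x ^ (a k.succ - 1 - i) := by
      ext k j
      simp [S]
    rw [h1]
    refine h.trans (sum_congr rfl fun b _ => ?_)
    rw [← prod_pow_eq_pow_sum, alternant, ← det_mul_column]
    change det _ = _
    congr 1
    ext k j
    simp [mul_comm]
  rw [hdet, det_succ_column B (Fin.last n), Fin.sum_univ_succ, sum_eq_zero, add_zero, hB0, ← hx,
    hsub, hmul]
  · have hneg : ∏ j : Fin n, (u j.castSucc - x) =
        (-1) ^ n * ∏ j : Fin n, (x - u j.castSucc) := by
      rw [← Fin.prod_const, ← prod_mul_distrib]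
      exact prod_congr rfl fun j _ => by ring
    rw [hneg, mul_sum, mul_sum, mul_sum]
    refine sum_congr rfl fun b _ => ?_
    -- The cofactor sign cancels the sign from reversing the `n` differences.
    have h1 : ((-1 : R) ^ n) * (-1) ^ n = 1 := by rw [← mul_pow]; simp
    simp only [Fin.val_zero, Fin.val_last, zero_add, pow_add]
    linear_combination (x ^ a 0 * (∏ j : Fin n, (x - u j.castSucc)) *
      (x ^ (∑ k, (a k.succ - 1 - b k)) * alternant b fun j => u j.castSucc)) * h1
  · intro k _
    simp [hBs, ← hx]

theorem alternant_eq_zero {R : Type*} [CommRing R] {n : ℕ} {a : Fin n → ℕ}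
    (ha : ¬ Function.Injective a) (u : Fin n → R) : alternant a u = 0 := by
  simp only [Function.Injective, not_forall] at ha
  obtain ⟨i, j, hij, hne⟩ := ha
  exact det_zero_of_row_eq hne (by ext; simp [hij])

theorem alternant_comp_perm {R : Type*} [CommRing R] {n : ℕ} (a : Fin n → ℕ)
    (τ : Equiv.Perm (Fin n)) (u : Fin n → R) :
    alternant (a ∘ τ) u = Equiv.Perm.sign τ * alternant a u :=
  det_permute τ (Matrix.of fun k j => u j ^ a k)

theorem coeff_det_entrywise {R : Type*} [CommRing R] (f : R⟦X⟧) {n : ℕ} (u v : Fin n → R)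
    (M : ℕ) :
    PowerSeries.coeff M (entrywise f
        ((PowerSeries.X : R⟦X⟧) • (vecMulVec u v).map (PowerSeries.C (R := R)))).det =
      ∑ a ∈ piAntidiag (univ : Finset (Fin n)) M,
        (∏ k, PowerSeries.coeff (a k) f) * (∏ k, u k ^ a k) * alternant a v := by
  have hentry (j k : Fin n) : entrywise f
      ((PowerSeries.X : R⟦X⟧) • (vecMulVec u v).map (PowerSeries.C (R := R))) j k =
        PowerSeries.rescale (u j * v k) f := by
    rw [PowerSeries.rescale_eq_subst]
    simp [entrywise, vecMulVec_apply, PowerSeries.smul_eq_C_mul, mul_comm]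
  have hprod (σ : Equiv.Perm (Fin n)) :
      PowerSeries.coeff M (∏ j, PowerSeries.rescale (u j * v (σ j)) f) =
        ∑ a ∈ piAntidiag (univ : Finset (Fin n)) M,
          (∏ k, PowerSeries.coeff (a k) f) * (∏ k, u k ^ a k) * ∏ k, v (σ k) ^ a k := by
    rw [PowerSeries.coeff_prod]
    refine sum_bij (fun a _ => ⇑a) (fun a ha => ?_) (fun a _ b _ h => DFunLike.coe_injective h)
      (fun a ha => ⟨Finsupp.equivFunOnFinite.symm a, ?_, rfl⟩) fun a _ => ?_
    · simpa using ha
    · simpa using ha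
    · rw [← prod_mul_distrib, ← prod_mul_distrib]
      refine prod_congr rfl fun k _ => ?_
      rw [PowerSeries.coeff_rescale]
      ring
  -- Transposing makes the permutation act on `v` only, so the `u`-monomial factors out.
  rw [← det_transpose, det_apply']
  simp only [transpose_apply, hentry, map_sum, alternant]
  simp only [← map_intCast (PowerSeries.C (R := R)), PowerSeries.coeff_C_mul, hprod]
  simp only [← det_transpose (Matrix.of fun k j => v j ^ _), det_apply', mul_sum]
  rw [sum_comm]
  refine sum_congr rfl fun a _ => sum_congr rfl fun σ _ => ?_
  simp only [transpose_apply, of_apply]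
  ring

open Classical in
theorem sum_piAntidiag_eq_sum_strictMono {R : Type*} [CommRing R] (c : ℕ → R) {n : ℕ}
    (u v : Fin n → R) (M : ℕ) :
    ∑ a ∈ piAntidiag (univ : Finset (Fin n)) M,
        (∏ k, c (a k)) * (∏ k, u k ^ a k) * alternant a v =
      ∑ a ∈ (piAntidiag (univ : Finset (Fin n)) M).filter StrictMono,
        alternant a u * alternant a v * ∏ k, c (a k) := by
  rw [← sum_filter_of_ne (p := Function.Injective) fun a _ h => by
    by_contra hi
    exact h (by rw [alternant_eq_zero hi, mul_zero])]
  -- The Leibniz sign of `τ` in the `u`-alternant is absorbed by permuting the rows of the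
  -- `v`-alternant.
  have hexp (a : Fin n → ℕ) : alternant a u * alternant a v * ∏ k, c (a k) =
      ∑ τ : Equiv.Perm (Fin n), (∏ k, c ((a ∘ τ) k)) * (∏ k, u k ^ (a ∘ τ) k) *
        alternant (a ∘ τ) v := by
    conv_lhs => rw [alternant, det_apply', sum_mul, sum_mul]
    refine sum_congr rfl fun τ _ => ?_
    rw [alternant_comp_perm, ← Equiv.prod_comp τ fun k => c (a k)]
    simp only [of_apply, Function.comp_apply]
    ring
  rw [sum_congr rfl fun a _ => hexp a, ← sum_product']
  symm
  -- An injective tuple is uniquely a rearrangement of a strictly increasing one, which is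
  -- determined by its range.
  refine sum_nbij (fun p => p.1 ∘ p.2) (fun p hp => ?_) (fun p hp q hq h => ?_) (fun a ha => ?_)
    fun _ _ => rfl
  · simp only [mem_product, mem_filter, mem_piAntidiag, mem_univ, and_true, implies_true] at hp ⊢
    refine ⟨?_, hp.2.injective.comp p.2.injective⟩
    rw [← hp.1]
    exact Equiv.sum_comp p.2 p.1
  · simp only [coe_product, Set.mem_prod, mem_coe, mem_filter] at hp hq
    have h' : p.1 ∘ p.2 = q.1 ∘ q.2 := h
    have h1 : p.1 = q.1 := by
      rw [← hp.1.2.range_inj hq.1.2, ← p.2.surjective.range_comp, h', q.2.surjective.range_comp]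
    refine Prod.ext h1 (Equiv.ext fun k => hq.1.2.injective ?_)
    rw [← h1]
    simpa [h1] using congrFun h' k
  · simp only [coe_filter, Set.mem_ofPred_eq, mem_piAntidiag, mem_univ, implies_true,
      and_true] at ha
    refine ⟨(a ∘ Tuple.sort a, (Tuple.sort a)⁻¹), ?_, ?_⟩
    · simp only [coe_product, Set.mem_prod, mem_coe, mem_filter, mem_piAntidiag, mem_univ,
        implies_true, and_true]
      refine ⟨?_, (Tuple.monotone_sort a).strictMono_of_injective
        (ha.2.comp (Tuple.sort a).injective)⟩
      rw [← ha.1]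
      exact Equiv.sum_comp (Tuple.sort a) a
    · ext k
      simp

end SchurDet

/-! ### Tableaux: branching rule and the bialternant formula -/

namespace SchurDet

open Finset Matrix

theorem le_apply_of_strictMono {N : ℕ} {a : Fin N → ℕ} (ha : StrictMono a) (k : Fin N) :
    (k : ℕ) ≤ a k := by
  obtain ⟨k, hk⟩ := k
  induction k with
  | zero => exact Nat.zero_le _
  | succ k ih =>
    exact Nat.succ_le_of_lt ((ih (by omega)).trans_lt (ha (Fin.lt_def.2 (Nat.lt_succ_self k))))

theorem mem_shape {N : ℕ} {a : Fin N → ℕ} (ha : StrictMono a) {i j : ℕ} :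
    (i, j) ∈ shape a ha ↔ ∃ k : Fin N, (k.rev : ℕ) = i ∧ j + k < a k := by
  rw [shape, YoungDiagram.mem_ofRowLens]
  simp only [rowList, List.length_ofFn, List.getElem_ofFn]
  constructor
  · rintro ⟨h, hj⟩
    exact ⟨Fin.rev ⟨i, h⟩, by rw [Fin.rev_rev], by omega⟩
  · rintro ⟨k, rfl, hj⟩
    exact ⟨k.rev.2, by simp only [Fin.eta, Fin.rev_rev]; omega⟩

theorem rev_mem_shape {N : ℕ} {a : Fin N → ℕ} (ha : StrictMono a) {k : Fin N} {j : ℕ} :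
    ((k.rev : ℕ), j) ∈ shape a ha ↔ j + k < a k := by
  rw [mem_shape]
  constructor
  · rintro ⟨l, hl, h⟩
    rwa [Fin.rev_injective (Fin.ext hl)] at h
  · exact fun h => ⟨k, rfl, h⟩

theorem rowLen_shape {N : ℕ} {a : Fin N → ℕ} (ha : StrictMono a) (k : Fin N) :
    (shape a ha).rowLen k.rev = a k - k := by
  refine eq_of_forall_lt_iff fun j => ?_
  rw [← YoungDiagram.mem_iff_lt_rowLen, rev_mem_shape]
  omega

theorem card_shape {N : ℕ} {a : Fin N → ℕ} (ha : StrictMono a) :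
    (shape a ha).cells.card = ∑ k, (a k - k) := by
  rw [card_eq_sum_card_fiberwise (f := Prod.fst) (t := univ.map ⟨fun k : Fin N => (k.rev : ℕ),
    fun _ _ h => Fin.rev_injective (Fin.ext h)⟩), sum_map]
  · refine sum_congr rfl fun k _ => ?_
    rw [← rowLen_shape ha, YoungDiagram.rowLen_eq_card]
    rfl
  · rintro ⟨i, j⟩ h
    obtain ⟨k, rfl, _⟩ := (mem_shape ha).1 h
    simp

/-- Identifies the exponent of the last variable in the alternant recursion with the number of
deleted cells. -/
theorem card_shape_eq {n : ℕ} {a : Fin (n + 1) → ℕ} {b : Fin n → ℕ} (ha : StrictMono a)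
    (hb : StrictMono b) (hab : b ∈ interlacing a) :
    (shape a ha).cells.card =
      (shape b hb).cells.card + (a 0 + ∑ k, (a k.succ - 1 - b k)) := by
  rw [card_shape, card_shape, Fin.sum_univ_succ, add_left_comm, ← sum_add_distrib]
  simp only [Fin.val_zero, Nat.sub_zero]
  congr 1
  refine sum_congr rfl fun k _ => ?_
  have h1 := mem_interlacing.1 hab k
  have h2 := le_apply_of_strictMono hb k
  simp only [Fin.val_succ]
  omega

theorem shape_le_of_mem_interlacing {n : ℕ} {a : Fin (n + 1) → ℕ} {b : Fin n → ℕ}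
    (ha : StrictMono a) (hb : StrictMono b) (hab : b ∈ interlacing a) :
    shape b hb ≤ shape a ha := by
  rintro ⟨i, j⟩ h
  change (i, j) ∈ shape b hb at h
  obtain ⟨k, rfl, hk⟩ := (mem_shape hb).1 h
  have := (mem_interlacing.1 hab k).2
  refine (mem_shape ha).2 ⟨k.succ, ?_, ?_⟩
  · simp [Fin.val_rev]
  · simp only [Fin.val_succ]; omega

theorem mem_shape_of_succ_mem {n : ℕ} {a : Fin (n + 1) → ℕ} {b : Fin n → ℕ}
    (ha : StrictMono a) (hb : StrictMono b) (hab : b ∈ interlacing a) {i j : ℕ}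
    (h : (i + 1, j) ∈ shape a ha) : (i, j) ∈ shape b hb := by
  obtain ⟨k, hi, hk⟩ := (mem_shape ha).1 h
  have hlt : (k : ℕ) < n := by rw [Fin.val_rev] at hi; omega
  have := (mem_interlacing.1 hab ⟨k, hlt⟩).1
  refine (mem_shape hb).2 ⟨⟨k, hlt⟩, ?_, ?_⟩
  · simp only [Fin.val_rev] at hi ⊢; omega
  · exact hk.trans_le this

namespace Tableau

variable {μ ν : YoungDiagram} {n : ℕ}

/-- The cells of a tableau with entries in `0, …, n` whose entry is not the largest letter. -/
def restrict (T : Tableau ν (n + 1)) : YoungDiagram where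
  cells := ν.cells.filter fun c => T.1 c.1 c.2 < n
  isLowerSet := by
    rintro ⟨i₂, j₂⟩ ⟨i₁, j₁⟩ ⟨hi, hj⟩ h
    simp only [coe_filter, Set.mem_ofPred_eq, YoungDiagram.mem_cells] at h ⊢
    refine ⟨ν.up_left_mem hi hj h.1, lt_of_le_of_lt ?_ h.2⟩
    exact (T.1.row_weak_of_le hj (ν.up_left_mem hi le_rfl h.1)).trans (T.1.col_weak hi h.1)

theorem mem_restrict {T : Tableau ν (n + 1)} {i j : ℕ} :
    (i, j) ∈ T.restrict ↔ (i, j) ∈ ν ∧ T.1 i j < n := by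
  rw [← YoungDiagram.mem_cells]
  simp [restrict]

/-- A cell with another below it cannot hold the largest letter, so the deleted cells form a
horizontal strip. -/
theorem mem_restrict_of_succ_mem (T : Tableau ν (n + 1)) {i j : ℕ} (h : (i + 1, j) ∈ ν) :
    (i, j) ∈ T.restrict := by
  refine mem_restrict.2 ⟨ν.up_left_mem (Nat.le_succ i) le_rfl h, ?_⟩
  have h1 := T.1.col_strict (lt_add_one i) h
  have h2 := T.2 _ ((YoungDiagram.mem_cells _).2 h)
  dsimp only at h2
  omega

theorem le_entry (T : SemistandardYoungTableau ν) {i j : ℕ} (h : (i, j) ∈ ν) : i ≤ T i j := by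
  induction i with
  | zero => exact Nat.zero_le _
  | succ i ih =>
    have h1 := T.col_strict (lt_add_one i) h
    have h2 := ih (ν.up_left_mem (Nat.le_succ i) le_rfl h)
    omega

/-- The tableau of shape `μ` that remains after the largest letter is removed. -/
def lower (T : Tableau ν (n + 1)) (h : T.restrict = μ) : Tableau μ n :=
  ⟨{ entry := fun i j => if (i, j) ∈ μ then T.1 i j else 0
     row_weak' := fun {i j₁ j₂} hj hc => by
      rw [if_pos hc, if_pos (μ.up_left_mem le_rfl hj.le hc)]
      exact T.1.row_weak hj (mem_restrict.1 (h ▸ hc)).1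
     col_strict' := fun {i₁ i₂ j} hi hc => by
      rw [if_pos hc, if_pos (μ.up_left_mem hi.le le_rfl hc)]
      exact T.1.col_strict hi (mem_restrict.1 (h ▸ hc)).1
     zeros' := fun hc => if_neg hc }, fun c hc => by
      have hc' : (c.1, c.2) ∈ μ := hc
      change (if (c.1, c.2) ∈ μ then T.1 c.1 c.2 else 0) < n
      rw [if_pos hc']
      exact (mem_restrict.1 (h ▸ hc')).2⟩

theorem lower_apply (T : Tableau ν (n + 1)) (h : T.restrict = μ) (i j : ℕ) :
    (T.lower h).1 i j = if (i, j) ∈ μ then T.1 i j else 0 :=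
  rfl

/-- The extension of a tableau of shape `μ` to shape `ν` by a new largest letter. -/
def extend (S : Tableau μ n) (hle : μ ≤ ν) (hs : ∀ i j, (i + 1, j) ∈ ν → (i, j) ∈ μ) :
    Tableau ν (n + 1) :=
  have hlt {i j : ℕ} (h : (i, j) ∈ μ) : S.1 i j < n := S.2 (i, j) h
  ⟨{ entry := fun i j => if (i, j) ∈ μ then S.1 i j else if (i, j) ∈ ν then n else 0
     row_weak' := fun {i j₁ j₂} hj hc => by
      by_cases h : (i, j₂) ∈ μ
      · rw [if_pos h, if_pos (μ.up_left_mem le_rfl hj.le h)]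
        exact S.1.row_weak hj h
      · rw [if_neg h, if_pos hc, if_pos (ν.up_left_mem le_rfl hj.le hc)]
        split_ifs with h'
        · exact (hlt h').le
        · exact le_rfl
     col_strict' := fun {i₁ i₂ j} hi hc => by
      -- By `hs` the new letter occurs at most once per column, at its bottom.
      have h₁ : (i₁, j) ∈ μ := hs i₁ j (ν.up_left_mem hi le_rfl hc)
      rw [if_pos h₁]
      split_ifs with h
      · exact S.1.col_strict hi h
      · exact hlt h₁
     zeros' := fun hc => by rw [if_neg fun h => hc (hle h), if_neg hc] }, fun c hc => by
      change (if (c.1, c.2) ∈ μ then S.1 c.1 c.2 else if (c.1, c.2) ∈ ν then n else 0) < n + 1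
      split_ifs with h
      · exact (hlt h).trans (Nat.lt_succ_self n)
      · exact Nat.lt_succ_self n
      · exact Nat.succ_pos n⟩

theorem extend_apply (S : Tableau μ n) (hle : μ ≤ ν) (hs : ∀ i j, (i + 1, j) ∈ ν → (i, j) ∈ μ)
    (i j : ℕ) : (S.extend hle hs).1 i j =
      if (i, j) ∈ μ then S.1 i j else if (i, j) ∈ ν then n else 0 :=
  rfl

theorem restrict_extend (S : Tableau μ n) (hle : μ ≤ ν)
    (hs : ∀ i j, (i + 1, j) ∈ ν → (i, j) ∈ μ) : (S.extend hle hs).restrict = μ := by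
  ext ⟨i, j⟩
  rw [YoungDiagram.mem_cells, YoungDiagram.mem_cells, mem_restrict, extend_apply]
  by_cases h : (i, j) ∈ μ
  · simpa [h, show (i, j) ∈ ν from hle h] using S.2 (i, j) h
  · simp +contextual [h]

theorem lower_extend (S : Tableau μ n) (hle : μ ≤ ν)
    (hs : ∀ i j, (i + 1, j) ∈ ν → (i, j) ∈ μ) :
    (S.extend hle hs).lower (restrict_extend S hle hs) = S := by
  refine Subtype.ext (SemistandardYoungTableau.ext fun i j => ?_)
  rw [lower_apply, extend_apply]
  split_ifs with h
  · rfl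
  · exact (S.1.zeros h).symm

theorem extend_lower (T : Tableau ν (n + 1)) (h : T.restrict = μ) (hle : μ ≤ ν)
    (hs : ∀ i j, (i + 1, j) ∈ ν → (i, j) ∈ μ) : (T.lower h).extend hle hs = T := by
  refine Subtype.ext (SemistandardYoungTableau.ext fun i j => ?_)
  rw [extend_apply, lower_apply]
  split_ifs with h1 h2
  · rfl
  · have h3 := T.2 _ ((YoungDiagram.mem_cells _).2 h2)
    rw [← h, mem_restrict] at h1
    dsimp only at h3
    by_contra hne
    exact h1 ⟨h2, by omega⟩
  · exact (T.1.zeros h2).symm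

theorem weight_eq_mul_weight_lower {R : Type*} [CommRing R] (T : Tableau ν (n + 1))
    (h : T.restrict = μ) {d : ℕ} (hd : ν.cells.card = μ.cells.card + d) (u : Fin (n + 1) → R) :
    T.weight u = u (Fin.last n) ^ d * (T.lower h).weight fun j => u j.castSucc := by
  rw [weight, Fin.prod_univ_castSucc, mul_comm, weight]
  have hcells : μ.cells = ν.cells.filter fun c => T.1 c.1 c.2 < n := by rw [← h]; rfl
  congr 2
  · have h1 := card_filter_add_card_filter_not (s := ν.cells) fun c => T.1 c.1 c.2 < n
    rw [← hcells, hd, add_right_inj] at h1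
    rw [← h1]
    congr 1
    refine filter_congr fun c hc => ?_
    have := T.2 c hc
    rw [Fin.val_last]
    omega
  · funext j
    congr 2
    ext c
    simp only [mem_filter, hcells, lower_apply, Fin.val_castSucc]
    constructor
    · rintro ⟨h1, h2⟩
      have h3 : T.1 c.1 c.2 < n := h2 ▸ j.2
      refine ⟨⟨h1, h3⟩, ?_⟩
      rw [if_pos (h ▸ mem_restrict.2 ⟨h1, h3⟩)]
      exact h2
    · rintro ⟨⟨h1, h3⟩, h2⟩
      rw [if_pos (h ▸ mem_restrict.2 ⟨h1, h3⟩)] at h2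
      exact ⟨h1, h2⟩

/-- The strictly increasing tuple that encodes the shape of `T.restrict`. -/
def restrictTuple (T : Tableau ν (n + 1)) (k : Fin n) : ℕ :=
  T.restrict.rowLen k.rev + k

theorem restrictTuple_mem_interlacing {a : Fin (n + 1) → ℕ} (ha : StrictMono a)
    (T : Tableau (shape a ha) (n + 1)) : T.restrictTuple ∈ interlacing a := by
  rw [mem_interlacing]
  intro k
  constructor
  · by_contra! h
    have h1 : ((k.rev : ℕ) + 1, T.restrict.rowLen k.rev) ∈ shape a ha :=
      (mem_shape ha).2 ⟨k.castSucc, by simp only [Fin.val_rev, Fin.val_castSucc]; omega, h⟩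
    exact (YoungDiagram.mem_iff_lt_rowLen.1 (T.mem_restrict_of_succ_mem h1)).false
  · have h0 : T.restrict.rowLen k.rev ≤ (shape a ha).rowLen k.rev := by
      refine le_of_forall_lt fun j hj => ?_
      exact YoungDiagram.mem_iff_lt_rowLen.1
        (mem_restrict.1 (YoungDiagram.mem_iff_lt_rowLen.2 hj)).1
    have h1 := rowLen_shape ha k.succ
    have h2 : ((k.succ.rev : Fin (n + 1)) : ℕ) = k.rev := by simp [Fin.val_rev]
    rw [h2, Fin.val_succ] at h1
    have h3 := le_apply_of_strictMono ha k.succ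
    rw [Fin.val_succ] at h3
    rw [restrictTuple]
    omega

theorem restrictTuple_eq_iff {T : Tableau ν (n + 1)} {b : Fin n → ℕ} (hb : StrictMono b) :
    T.restrictTuple = b ↔ T.restrict = shape b hb := by
  constructor
  · intro h
    ext ⟨i, j⟩
    rw [YoungDiagram.mem_cells, YoungDiagram.mem_cells, mem_shape]
    subst h
    simp only [restrictTuple, add_lt_add_iff_right, ← YoungDiagram.mem_iff_lt_rowLen]
    constructor
    · intro h
      obtain ⟨h1, h2⟩ := mem_restrict.1 h
      -- Column strictness bounds the row index by the entry, so only `n` rows survive.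
      refine ⟨Fin.rev ⟨i, (le_entry T.1 h1).trans_lt h2⟩, ?_, ?_⟩ <;> simp [h]
    · rintro ⟨k, rfl, h⟩
      exact h
  · intro h
    funext k
    rw [restrictTuple, h, rowLen_shape]
    exact Nat.sub_add_cancel (le_apply_of_strictMono hb k)

end Tableau

theorem schur_succ {R : Type*} [CommRing R] {n : ℕ} {a : Fin (n + 1) → ℕ} (ha : StrictMono a)
    (u : Fin (n + 1) → R) :
    schur a u = ∑ b ∈ interlacing a, u (Fin.last n) ^ (a 0 + ∑ k, (a k.succ - 1 - b k)) *
      schur b fun j => u j.castSucc := by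
  classical
  rw [schur, dif_pos ha, ← sum_fiberwise_of_maps_to (g := Tableau.restrictTuple)
    fun T _ => T.restrictTuple_mem_interlacing ha]
  refine sum_congr rfl fun b hab => ?_
  have hb := strictMono_of_mem_interlacing ha hab
  have hle := shape_le_of_mem_interlacing ha hb hab
  have hs : ∀ i j, (i + 1, j) ∈ shape a ha → (i, j) ∈ shape b hb :=
    fun _ _ => mem_shape_of_succ_mem ha hb hab
  have hr {T : Tableau (shape a ha) (n + 1)}
      (hT : T ∈ univ.filter fun T : Tableau (shape a ha) (n + 1) => T.restrictTuple = b) :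
      T.restrict = shape b hb :=
    (Tableau.restrictTuple_eq_iff hb).1 (mem_filter.1 hT).2
  rw [schur, dif_pos hb, mul_sum]
  refine sum_bij' (fun T hT => T.lower (hr hT)) (fun S _ => S.extend hle hs)
    (fun _ _ => mem_univ _) (fun S _ => ?_) (fun T hT => T.extend_lower (hr hT) hle hs)
    (fun S _ => S.lower_extend hle hs)
    fun T hT => T.weight_eq_mul_weight_lower (hr hT) (card_shape_eq ha hb hab) u
  simpa using (Tableau.restrictTuple_eq_iff hb).2 (S.restrict_extend hle hs)

theorem schur_fin_zero {R : Type*} [CommRing R] (a : Fin 0 → ℕ) (u : Fin 0 → R) :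
    schur a u = 1 := by
  have ha : StrictMono a := fun i => i.elim0
  have hnot (i j : ℕ) : (i, j) ∉ shape a ha := fun h => by
    obtain ⟨k, _⟩ := (mem_shape ha).1 h
    exact k.elim0
  let T₀ : Tableau (shape a ha) 0 :=
    ⟨.highestWeight _, fun c hc => (hnot c.1 c.2 hc).elim⟩
  rw [schur, dif_pos ha, sum_eq_single T₀, Tableau.weight, Fin.prod_univ_zero]
  · refine fun T _ hT => (hT (Subtype.ext (SemistandardYoungTableau.ext fun i j => ?_))).elim
    rw [T.1.zeros (hnot i j), T₀.1.zeros (hnot i j)]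
  · exact fun h => (h (mem_univ _)).elim

/-- The bialternant formula for Schur polynomials. -/
theorem alternant_eq_vandermondeDet_mul_schur {R : Type*} [CommRing R] {n : ℕ} {a : Fin n → ℕ}
    (ha : StrictMono a) (u : Fin n → R) : alternant a u = vandermondeDet u * schur a u := by
  induction n with
  | zero => simp [alternant, vandermondeDet, schur_fin_zero]
  | succ n ih =>
    rw [alternant_succ ha.monotone, schur_succ ha, vandermondeDet_succ, mul_sum, mul_sum]
    refine sum_congr rfl fun b hb => ?_
    rw [ih (strictMono_of_mem_interlacing ha hb)]
    ring

theorem choose_two_le_sum {n : ℕ} {a : Fin n → ℕ} (ha : StrictMono a) :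
    n.choose 2 ≤ ∑ k, a k := by
  rw [Nat.choose_two_right, ← sum_range_id, ← Fin.sum_univ_eq_sum_range]
  exact sum_le_sum fun k _ => le_apply_of_strictMono ha k

end SchurDet

theorem theoremC {R : Type*} [CommRing R] (f : R⟦X⟧) (n : ℕ) (hn : 1 ≤ n) (u v : Fin n → R) :
    (SchurDet.entrywise f
        ((PowerSeries.X : R⟦X⟧) • (Matrix.vecMulVec u v).map (PowerSeries.C (R := R)))).det =
      PowerSeries.C (SchurDet.vandermondeDet u * SchurDet.vandermondeDet v) *
        PowerSeries.mk fun M =>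
          if n.choose 2 ≤ M then
            ∑ m ∈ SchurDet.partitions n M,
              SchurDet.schur m u * SchurDet.schur m v * ∏ k : Fin n, PowerSeries.coeff (m k) f
          else 0 := by
  classical
  ext M
  rw [SchurDet.coeff_det_entrywise,
    SchurDet.sum_piAntidiag_eq_sum_strictMono fun k => PowerSeries.coeff k f,
    PowerSeries.coeff_C_mul, PowerSeries.coeff_mk]
  split_ifs with hM
  · rw [Finset.mul_sum]
    -- Monotone tuples that are not strict have Schur value zero.
    refine Finset.sum_subset_zero_on_sdiff (fun m hm => ?_) (fun m hm => ?_) fun m hm => ?_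
    · rw [Finset.mem_filter] at hm
      exact Finset.mem_filter.2 ⟨hm.1, hm.2.monotone⟩
    · rw [Finset.mem_sdiff, SchurDet.partitions, Finset.mem_filter, Finset.mem_filter] at hm
      rw [SchurDet.schur, dif_neg fun h => hm.2 ⟨hm.1.1, h⟩]
      ring
    · have h := (Finset.mem_filter.1 hm).2
      rw [SchurDet.alternant_eq_vandermondeDet_mul_schur h,
        SchurDet.alternant_eq_vandermondeDet_mul_schur h]
      ring
  · rw [mul_zero]
    refine Finset.sum_eq_zero fun m hm => (hM ?_).elim
    rw [Finset.mem_filter, Finset.mem_piAntidiag] at hm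
    exact (SchurDet.choose_two_le_sum hm.2).trans_eq hm.1.1
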